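/- Let $n\ge 1$, let $d_1,\dots,d_n\ge 1$, and let $\mathcal S=\{|\psi_i\rangle\}_{i=1}^N$ be an orthonormal basis of $\bigotimes_{k=1}^n\mathbb C^{d_k}$ (so $N=d_1\cdots d_n$), the $k$-th tensor factor being held by the $k$-th of $n$ spatially separated parties. Say that $|\psi_i\rangle\in\mathcal S$ can be authenticated locally if there is a two-outcome measurement $\{M^{(0)},M^{(1)}\}$, implementable by local operations and classical communication (LOCC) among the $n$ fully separated parties with finitely or infinitely many rounds, which perfectly answers the question "is the state $|\psi_i\rangle$?" for every state of $\mathcal S$: $\langle\psi_i|M^{(1)}|\psi_i\rangle=1$ and $\langle\psi_j|M^{(0)}|\psi_j\rangle=1$ for all $j\ne i$. Say that $\mathcal S$ allows complete local random authentication (LRA) if all of its elements can be authenticated locally, and partial LRA if exactly $k$ of them can, for some $1\le k<N$. If no $|\psi_i\rangle$ is fully product, i.e. of the form $|\varphi_1\rangle\otimes\cdots\otimes|\varphi_n\rangle$, then no element of $\mathcal S$ can be authenticated locally. In particular, $\mathcal S$ allows neither partial nor complete LRA. -/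

import Mathlib

open scoped Matrix Topology

namespace LocalAuth

/-- Labels of the computational basis of `ℂ^{d 0} ⊗ ⋯ ⊗ ℂ^{d (n-1)}`: one label per party. -/
abbrev MultiIndex {n : ℕ} (d : Fin n → ℕ) : Type := (k : Fin n) → Fin (d k)

/-- The `n`-partite Hilbert space `ℂ^{d 0} ⊗ ⋯ ⊗ ℂ^{d (n-1)}`, with vectors written in
coordinates with respect to the product of the computational bases. -/
abbrev MultiSpace {n : ℕ} (d : Fin n → ℕ) : Type := EuclideanSpace ℂ (MultiIndex d)

/-- `ψ = φ 0 ⊗ φ 1 ⊗ ⋯ ⊗ φ (n-1)` for some local vectors `φ k`. -/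
def IsFullyProduct {n : ℕ} {d : Fin n → ℕ} (ψ : MultiSpace d) : Prop :=
  ∃ φ : (k : Fin n) → EuclideanSpace ℂ (Fin (d k)), ∀ x : MultiIndex d, ψ x = ∏ k, φ k (x k)

/-- The tensor product `A 0 ⊗ A 1 ⊗ ⋯ ⊗ A (n-1)` of local operators `A k : ℂ^{d k} → ℂ^{e k}`. -/
def tensorOp {n : ℕ} {d e : Fin n → ℕ} (A : (k : Fin n) → Matrix (Fin (e k)) (Fin (d k)) ℂ) :
    Matrix (MultiIndex e) (MultiIndex d) ℂ :=
  Matrix.of fun y x => ∏ k, A k (y k) (x k)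

/-- Finite-round LOCC protocols with a binary answer (`true` is "yes", `false` is "no"), for `n`
separated parties whose systems currently have dimensions `d`.

Either the parties stop and announce an answer, or they run one more round: a party `p` performs
a local measurement with `m` outcomes and Kraus operators `K j p`, and broadcasts the outcome `j`;
every other party `k` then applies a local isometry `K j k`, which may depend on `j`. The
protocol goes on in a way that may depend on `j`. The dimensions after the round are `e j`, so
parties may attach ancillas and discard subsystems. Discarding a system or forgetting an outcome is
a measurement whose result is not used later on. -/
inductive Protocol {n : ℕ} : (Fin n → ℕ) → Type
  | answer {d : Fin n → ℕ} (b : Bool) : Protocol d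
  | round {d : Fin n → ℕ} (p : Fin n) (m : ℕ) (e : Fin m → Fin n → ℕ)
      (K : (j : Fin m) → (k : Fin n) → Matrix (Fin (e j k)) (Fin (d k)) ℂ)
      (complete : ∑ j, (K j p)ᴴ * K j p = 1)
      (isometry : ∀ j k, k ≠ p → (K j k)ᴴ * K j k = 1)
      (next : (j : Fin m) → Protocol (e j)) : Protocol d

/-- The element of the induced two-outcome POVM that belongs to the final answer `y`. -/
def Protocol.effect {n : ℕ} (y : Bool) :
    {d : Fin n → ℕ} → Protocol d → Matrix (MultiIndex d) (MultiIndex d) ℂ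
  | _, .answer b => if b = y then 1 else 0
  | _, .round _ _ _ K _ _ next =>
      ∑ j, (tensorOp (K j))ᴴ * Protocol.effect y (next j) * tensorOp (K j)

/-- `Q` extends `P`: it performs the rounds of `P` and then, where `P` stops and announces an
answer, possibly further rounds; the (provisional) answers of `P` are not binding for `Q`. -/
inductive Protocol.Extends {n : ℕ} : {d : Fin n → ℕ} → Protocol d → Protocol d → Prop
  | answer {d : Fin n → ℕ} (b : Bool) (Q : Protocol d) : Extends (.answer b) Q
  | round {d : Fin n → ℕ} (p : Fin n) (m : ℕ) (e : Fin m → Fin n → ℕ)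
      (K : (j : Fin m) → (k : Fin n) → Matrix (Fin (e j k)) (Fin (d k)) ℂ)
      (complete : ∑ j, (K j p)ᴴ * K j p = 1)
      (isometry : ∀ j k, k ≠ p → (K j k)ᴴ * K j k = 1)
      (P Q : (j : Fin m) → Protocol (e j)) (h : ∀ j, Extends (P j) (Q j)) :
      Extends (.round p m e K complete isometry P) (.round p m e K complete isometry Q)

/-- The two-outcome measurement `{M false, M true}` can be implemented by LOCC among the `n` fully
separated parties, with finitely or infinitely many rounds: it is the limit of the measurements
of finite-round protocols, each of which extends the previous one. (A finite-round protocol is a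
constant sequence.) -/
def IsLOCC {n : ℕ} {d : Fin n → ℕ} (M : Bool → Matrix (MultiIndex d) (MultiIndex d) ℂ) : Prop :=
  ∃ P : ℕ → Protocol d, (∀ t, (P t).Extends (P (t + 1))) ∧
    ∀ y, Filter.Tendsto (fun t => (P t).effect y) Filter.atTop (𝓝 (M y))

/-- Born rule: the probability `⟨ψ| E |ψ⟩` of the effect `E` in the state `ψ`. -/
def bornProb {n : ℕ} {d : Fin n → ℕ} (E : Matrix (MultiIndex d) (MultiIndex d) ℂ)
    (ψ : MultiSpace d) : ℝ :=
  (star ψ.ofLp ⬝ᵥ (E *ᵥ ψ.ofLp)).re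

/-- The member `ψ i` of the family `ψ` can be authenticated locally: some LOCC measurement answers
the question "is the state `ψ i`?" correctly with certainty, whichever member was distributed. -/
def LocallyAuthenticable {n : ℕ} {d : Fin n → ℕ} {ι : Type*} (ψ : ι → MultiSpace d) (i : ι) :
    Prop :=
  ∃ M : Bool → Matrix (MultiIndex d) (MultiIndex d) ℂ, IsLOCC M ∧
    bornProb (M true) (ψ i) = 1 ∧ ∀ j, j ≠ i → bornProb (M false) (ψ j) = 1

/-- Complete local random authentication: every member can be authenticated locally. -/
def AllowsCompleteLRA {n : ℕ} {d : Fin n → ℕ} {ι : Type*} (ψ : ι → MultiSpace d) : Prop :=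
  ∀ i, LocallyAuthenticable ψ i

/-- Partial local random authentication: exactly `k` members can be authenticated locally, for
some `k` with `1 ≤ k < N`, where `N` is the number of members. -/
def AllowsPartialLRA {n : ℕ} {d : Fin n → ℕ} {ι : Type*} (ψ : ι → MultiSpace d) : Prop :=
  1 ≤ {i | LocallyAuthenticable ψ i}.ncard ∧ {i | LocallyAuthenticable ψ i}.ncard < Nat.card ι

end LocalAuth

namespace LocalAuth

variable {n : ℕ} {d e f : Fin n → ℕ}

/-! Every effect `E` of a finite-round protocol is a sum of terms `Bᴴ B` with `B` a product
operator. The rows of `B` are product vectors, so `E` is a sum of projectors onto unnormalised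
product vectors. If `v` is a unit vector that is not fully product, compactness bounds its squared
overlap with all product unit vectors by some `m < 1`; hence `⟨v|E|v⟩ ≤ m tr E`
(`re_dotProduct_conj_effect_le`, `exists_overlap_bound`). This inequality is closed, so it survives
the limit of infinitely many rounds. Perfect authentication of `v` within an orthonormal basis
forces `⟨v|E|v⟩ = 1 = tr E`, a contradiction. -/

lemma tensorOp_mul (A : (k : Fin n) → Matrix (Fin (f k)) (Fin (e k)) ℂ)
    (B : (k : Fin n) → Matrix (Fin (e k)) (Fin (d k)) ℂ) :
    tensorOp A * tensorOp B = tensorOp fun k => A k * B k := by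
  ext y x
  simp only [tensorOp, Matrix.mul_apply, Matrix.of_apply, ← Finset.prod_mul_distrib]
  exact (Fintype.prod_sum fun k i => A k (y k) i * B k i (x k)).symm

lemma tensorOp_conjTranspose (A : (k : Fin n) → Matrix (Fin (e k)) (Fin (d k)) ℂ) :
    (tensorOp A)ᴴ = tensorOp fun k => (A k)ᴴ := by
  ext y x
  simp [tensorOp, Matrix.conjTranspose_apply]

lemma tensorOp_one : tensorOp (fun k => (1 : Matrix (Fin (d k)) (Fin (d k)) ℂ)) = 1 := by
  ext y x
  by_cases h : y = x
  · subst h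
    simp [tensorOp]
  · obtain ⟨k, hk⟩ := Function.ne_iff.mp h
    rw [Matrix.one_apply_ne h]
    exact Finset.prod_eq_zero (Finset.mem_univ k) (Matrix.one_apply_ne hk)

/-- The Kraus operators of one round of an LOCC protocol are complete. -/
lemma sum_tensorOp_conjTranspose_mul (p : Fin n) {m : ℕ} (e : Fin m → Fin n → ℕ)
    (K : (j : Fin m) → (k : Fin n) → Matrix (Fin (e j k)) (Fin (d k)) ℂ)
    (complete : ∑ j, (K j p)ᴴ * K j p = 1)
    (isometry : ∀ j k, k ≠ p → (K j k)ᴴ * K j k = 1) :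
    ∑ j, (tensorOp (K j))ᴴ * tensorOp (K j) = 1 := by
  rw [← tensorOp_one]
  simp only [tensorOp_conjTranspose, tensorOp_mul]
  ext y x
  simp only [tensorOp, Matrix.sum_apply, Matrix.of_apply]
  -- Only the factor of the measuring party `p` has to be summed; each other factor is already the
  -- identity for every outcome.
  simp only [← Finset.mul_prod_erase Finset.univ _ (Finset.mem_univ p)]
  rw [← complete, Matrix.sum_apply, Finset.sum_mul]
  refine Finset.sum_congr rfl fun j _ => ?_
  congr 1
  refine Finset.prod_congr rfl fun k hk => ?_
  rw [isometry j k (Finset.ne_of_mem_erase hk)]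

lemma Protocol.effect_true_add_effect_false (P : Protocol d) :
    P.effect true + P.effect false = 1 := by
  induction P with
  | answer b => cases b <;> simp [Protocol.effect]
  | round p m e K complete isometry next ih =>
    simp only [Protocol.effect, ← Finset.sum_add_distrib, ← Matrix.add_mul, ← Matrix.mul_add, ih,
      Matrix.mul_one]
    exact sum_tensorOp_conjTranspose_mul p e K complete isometry

/-- A vector whose squared overlap with every product vector `φ` is at most `m * ‖φ‖ ^ 2`
has expectation at most `m * tr E` in every LOCC effect `E`, also after a product of local
operators. -/
lemma Protocol.re_dotProduct_conj_effect_le (y : Bool) {v : MultiIndex d → ℂ} {m : ℝ}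
    (hm : ∀ φ : (k : Fin n) → Fin (d k) → ℂ,
      ‖∑ x : MultiIndex d, (∏ k, φ k (x k)) * v x‖ ^ 2 ≤
        m * ∑ x : MultiIndex d, ‖∏ k, φ k (x k)‖ ^ 2)
    (P : Protocol e) (B : (k : Fin n) → Matrix (Fin (e k)) (Fin (d k)) ℂ) :
    (star v ⬝ᵥ (((tensorOp B)ᴴ * P.effect y * tensorOp B) *ᵥ v)).re ≤
      m * ((tensorOp B)ᴴ * P.effect y * tensorOp B).trace.re := by
  -- `B` stays general: it accumulates the local operators of the rounds already performed.
  induction P with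
  | answer b =>
    by_cases hb : b = y
    · simp only [Protocol.effect, hb, if_true, Matrix.mul_one]
      have h₁ : (star v ⬝ᵥ (((tensorOp B)ᴴ * tensorOp B) *ᵥ v)).re =
          ∑ z, ‖(tensorOp B *ᵥ v) z‖ ^ 2 := by
        rw [← Matrix.mulVec_mulVec, Matrix.dotProduct_mulVec, ← Matrix.star_mulVec, dotProduct,
          Complex.re_sum]
        refine Finset.sum_congr rfl fun z _ => ?_
        rw [Pi.star_apply, Complex.star_def, ← Complex.normSq_eq_conj_mul_self, Complex.ofReal_re,
          Complex.normSq_eq_norm_sq]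
      have h₂ : ((tensorOp B)ᴴ * tensorOp B).trace.re =
          ∑ z, ∑ x, ‖tensorOp B z x‖ ^ 2 := by
        rw [Finset.sum_comm, Matrix.trace, Complex.re_sum]
        refine Finset.sum_congr rfl fun x _ => ?_
        rw [Matrix.diag_apply, Matrix.mul_apply, Complex.re_sum]
        refine Finset.sum_congr rfl fun z _ => ?_
        rw [Matrix.conjTranspose_apply, Complex.star_def, ← Complex.normSq_eq_conj_mul_self,
          Complex.ofReal_re, Complex.normSq_eq_norm_sq]
      rw [h₁, h₂, Finset.mul_sum]
      -- Row `z` of `tensorOp B` is the product of the rows `B k (z k)`.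
      exact Finset.sum_le_sum fun z _ => hm fun k => B k (z k)
    · simp [Protocol.effect, hb]
  | round p r e K complete isometry next ih =>
    have key : (tensorOp B)ᴴ * (Protocol.round p r e K complete isometry next).effect y *
        tensorOp B = ∑ j, (tensorOp fun k => K j k * B k)ᴴ * (next j).effect y *
          tensorOp fun k => K j k * B k := by
      simp only [Protocol.effect, Matrix.mul_sum, Matrix.sum_mul, ← tensorOp_mul,
        Matrix.conjTranspose_mul, Matrix.mul_assoc]
    rw [key, Matrix.trace_sum, Matrix.sum_mulVec, dotProduct_sum, Complex.re_sum, Complex.re_sum,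
      Finset.mul_sum]
    exact Finset.sum_le_sum fun j _ => ih j _

lemma Protocol.re_dotProduct_effect_le (y : Bool) {v : MultiIndex d → ℂ} {m : ℝ}
    (hm : ∀ φ : (k : Fin n) → Fin (d k) → ℂ,
      ‖∑ x : MultiIndex d, (∏ k, φ k (x k)) * v x‖ ^ 2 ≤
        m * ∑ x : MultiIndex d, ‖∏ k, φ k (x k)‖ ^ 2)
    (P : Protocol d) :
    (star v ⬝ᵥ (P.effect y *ᵥ v)).re ≤ m * (P.effect y).trace.re := by
  simpa [tensorOp_one] using P.re_dotProduct_conj_effect_le y hm fun k => 1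

lemma sum_norm_prod_sq (φ : (k : Fin n) → EuclideanSpace ℂ (Fin (d k))) :
    ∑ x : MultiIndex d, ‖∏ k, φ k (x k)‖ ^ 2 = ∏ k, ‖φ k‖ ^ 2 := by
  simp only [EuclideanSpace.norm_sq_eq, norm_prod, ← Finset.prod_pow]
  exact (Fintype.prod_sum fun k i => ‖φ k i‖ ^ 2).symm

/-- A unit vector of maximal overlap with a product unit vector is itself a product vector. -/
lemma isFullyProduct_of_one_le_overlap (hn : 0 < n) {v : MultiSpace d} (hv : ‖v‖ = 1)
    {φ : (k : Fin n) → EuclideanSpace ℂ (Fin (d k))} (hφ : ∀ k, ‖φ k‖ = 1)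
    (h : 1 ≤ ‖∑ x : MultiIndex d, (∏ k, φ k (x k)) * v x‖) : IsFullyProduct v := by
  -- The overlap is bilinear in `φ` and `v`, so the conjugate turns it into an inner product.
  let w : MultiSpace d := WithLp.toLp 2 fun x => star (∏ k, φ k (x k))
  have hw : ‖w‖ = 1 := by
    have : ‖w‖ ^ 2 = 1 := by
      rw [EuclideanSpace.norm_sq_eq]
      simpa only [w, norm_star, hφ, one_pow, Finset.prod_const_one] using sum_norm_prod_sq φ
    exact (pow_eq_one_iff_of_nonneg (norm_nonneg w) two_ne_zero).mp this
  have hin : inner ℂ w v = ∑ x : MultiIndex d, (∏ k, φ k (x k)) * v x := by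
    rw [PiLp.inner_apply]
    refine Finset.sum_congr rfl fun x _ => ?_
    simp [w, mul_comm]
  -- Equality in Cauchy–Schwarz makes `v` a multiple `r` of `w`.
  have heq : ‖inner ℂ w v‖ = ‖w‖ * ‖v‖ := by
    refine le_antisymm (norm_inner_le_norm w v) ?_
    rw [hin, hw, hv, one_mul]
    exact h
  obtain ⟨r, -, hr⟩ := (norm_inner_eq_norm_iff (norm_ne_zero_iff.mp (by simp [hw]))
    (norm_ne_zero_iff.mp (by simp [hv]))).mp heq
  -- The scalar `r` is absorbed into a single tensor factor, which exists because `n > 0`.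
  let p : Fin n := ⟨0, hn⟩
  refine ⟨fun k => WithLp.toLp 2 fun i => (if k = p then r else 1) * star (φ k i), fun x => ?_⟩
  simp only [Finset.prod_mul_distrib, Finset.prod_ite_eq', Finset.mem_univ, if_true]
  simp [hr, w]

/-- A unit vector that is not fully product has overlap bounded away from `1` with all product
vectors. -/
lemma exists_overlap_bound (hn : 0 < n) (hd : ∀ k, 0 < d k) {v : MultiSpace d} (hv : ‖v‖ = 1)
    (hprod : ¬ IsFullyProduct v) :
    ∃ m : ℝ, m < 1 ∧ ∀ φ : (k : Fin n) → Fin (d k) → ℂ,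
      ‖∑ x : MultiIndex d, (∏ k, φ k (x k)) * v x‖ ^ 2 ≤
        m * ∑ x : MultiIndex d, ‖∏ k, φ k (x k)‖ ^ 2 := by
  let g : ((k : Fin n) → EuclideanSpace ℂ (Fin (d k))) → ℝ :=
    fun φ => ‖∑ x : MultiIndex d, (∏ k, φ k (x k)) * v x‖ ^ 2
  have hg : Continuous g := by fun_prop
  let S : Set ((k : Fin n) → EuclideanSpace ℂ (Fin (d k))) :=
    Set.univ.pi fun k => Metric.sphere 0 1
  have hS : IsCompact S := isCompact_univ_pi fun k => isCompact_sphere 0 1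
  have hne : S.Nonempty := ⟨fun k => EuclideanSpace.single ⟨0, hd k⟩ 1, fun k _ => by simp⟩
  obtain ⟨u, hu, hmax⟩ := hS.exists_isMaxOn hne hg.continuousOn
  have hlt : g u < 1 := by
    by_contra! h
    refine hprod (isFullyProduct_of_one_le_overlap hn hv (φ := u)
      (fun k => by simpa using hu k trivial) ?_)
    exact (one_le_sq_iff₀ (norm_nonneg _)).mp h
  refine ⟨g u, hlt, fun φ => ?_⟩
  let φ' : (k : Fin n) → EuclideanSpace ℂ (Fin (d k)) := fun k => WithLp.toLp 2 (φ k)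
  have hnorm := sum_norm_prod_sq φ'
  simp only [φ'] at hnorm
  -- Both sides vanish if a factor is zero; otherwise each factor is normalised, both sides being
  -- homogeneous of degree two in it.
  by_cases h0 : ∃ k, φ' k = 0
  · obtain ⟨k, hk⟩ := h0
    have hz : ∀ x : MultiIndex d, ∏ k, φ k (x k) = 0 := fun x =>
      Finset.prod_eq_zero (Finset.mem_univ k) (congrArg (fun z => z.ofLp (x k)) hk)
    simp [hz]
  · push Not at h0
    let w : (k : Fin n) → EuclideanSpace ℂ (Fin (d k)) := fun k => ((‖φ' k‖ : ℂ)⁻¹) • φ' k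
    have hw : w ∈ S := fun k _ => by
      simp [w, norm_smul, inv_mul_cancel₀ (norm_ne_zero_iff.mpr (h0 k))]
    have hφw : ∀ k i, φ k i = (‖φ' k‖ : ℂ) * w k i := fun k i => by
      have : (‖φ' k‖ : ℂ) ≠ 0 := by exact_mod_cast norm_ne_zero_iff.mpr (h0 k)
      simp only [w, PiLp.smul_apply, smul_eq_mul, mul_inv_cancel_left₀ this]
      rfl
    have hle : g w ≤ g u := hmax hw
    have hsum : ‖∑ x : MultiIndex d, (∏ k, φ k (x k)) * v x‖ ^ 2 = (∏ k, ‖φ' k‖ ^ 2) * g w := by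
      simp only [hφw, Finset.prod_mul_distrib, mul_assoc, ← Finset.mul_sum, g, norm_mul, mul_pow,
        norm_prod, Complex.norm_real, norm_norm, Finset.prod_pow]
    rw [hsum, hnorm, mul_comm]
    exact mul_le_mul_of_nonneg_right hle (Finset.prod_nonneg fun k _ => sq_nonneg _)

lemma re_trace_eq_sum_bornProb {ι : Type*} [Fintype ι] (ψ : OrthonormalBasis ι ℂ (MultiSpace d))
    (E : Matrix (MultiIndex d) (MultiIndex d) ℂ) : E.trace.re = ∑ j, bornProb E (ψ j) := by
  have h : E.trace = ∑ j, star (ψ j).ofLp ⬝ᵥ (E *ᵥ (ψ j).ofLp) := by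
    rw [← Matrix.trace_toLin_eq E (PiLp.basisFun 2 ℂ (MultiIndex d)),
      ← Matrix.toLpLin_eq_toLin, LinearMap.trace_eq_sum_inner _ ψ]
    refine Finset.sum_congr rfl fun j _ => ?_
    rw [EuclideanSpace.inner_eq_star_dotProduct, dotProduct_comm]
    rfl
  rw [h, Complex.re_sum]
  rfl

lemma bornProb_add (E F : Matrix (MultiIndex d) (MultiIndex d) ℂ) (v : MultiSpace d) :
    bornProb (E + F) v = bornProb E v + bornProb F v := by
  simp [bornProb, Matrix.add_mulVec]

lemma bornProb_one (v : MultiSpace d) : bornProb 1 v = ‖v‖ ^ 2 := by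
  rw [bornProb, Matrix.one_mulVec, ← inner_self_eq_norm_sq (𝕜 := ℂ) v,
    EuclideanSpace.inner_eq_star_dotProduct, dotProduct_comm]
  rfl

/-- Only fully product members of an orthonormal basis can be authenticated locally. -/
theorem LocallyAuthenticable.isFullyProduct (hn : 0 < n) (hd : ∀ k, 0 < d k) {ι : Type*}
    [Fintype ι] {ψ : OrthonormalBasis ι ℂ (MultiSpace d)} {i : ι}
    (h : LocallyAuthenticable ψ i) : IsFullyProduct (ψ i) := by
  by_contra hprod
  obtain ⟨M, ⟨P, -, hP⟩, hi, hj⟩ := h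
  obtain ⟨m, hm1, hm⟩ := exists_overlap_bound hn hd (ψ.orthonormal.1 i) hprod
  have hadd : M true + M false = 1 := by
    refine tendsto_nhds_unique ((hP true).add (hP false)) ?_
    simp only [Protocol.effect_true_add_effect_false]
    exact tendsto_const_nhds
  -- In the basis `ψ` the diagonal of `M true` is `1` at `i` and `0` elsewhere.
  have htrace : (M true).trace.re = 1 := by
    rw [re_trace_eq_sum_bornProb ψ, Finset.sum_eq_single i _ (by simp), hi]
    intro j _ hji
    have := bornProb_add (M true) (M false) (ψ j)
    rw [hadd, bornProb_one, ψ.orthonormal.1 j, hj j hji] at this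
    linarith
  have hcB : Continuous fun E : Matrix (MultiIndex d) (MultiIndex d) ℂ => bornProb E (ψ i) := by
    unfold bornProb
    fun_prop
  have hcT : Continuous fun E : Matrix (MultiIndex d) (MultiIndex d) ℂ => m * E.trace.re := by
    fun_prop
  have hle : bornProb (M true) (ψ i) ≤ m * (M true).trace.re :=
    le_of_tendsto_of_tendsto' ((hcB.tendsto _).comp (hP true)) ((hcT.tendsto _).comp (hP true))
      fun t => (P t).re_dotProduct_effect_le true hm
  rw [hi, htrace, mul_one] at hle
  exact hle.not_gt hm1

end LocalAuth

theorem theorem3 {n : ℕ} (hn : 0 < n) (d : Fin n → ℕ) (hd : ∀ k, 0 < d k)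
    {ι : Type*} [Fintype ι] (ψ : OrthonormalBasis ι ℂ (LocalAuth.MultiSpace d))
    (hψ : ∀ i, ¬ LocalAuth.IsFullyProduct (ψ i)) :
    (∀ i, ¬ LocalAuth.LocallyAuthenticable ψ i) ∧
      ¬ LocalAuth.AllowsPartialLRA ψ ∧ ¬ LocalAuth.AllowsCompleteLRA ψ := by
  have hno : ∀ i, ¬ LocalAuth.LocallyAuthenticable ψ i := fun i h =>
    hψ i (h.isFullyProduct hn hd)
  refine ⟨hno, fun h => ?_, fun h => ?_⟩
  · have h1 := h.1
    simp [hno] at h1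
  -- Positive dimensions make the basis nonempty, so complete LRA is not vacuous.
  · have : Nonempty (LocalAuth.MultiIndex d) := ⟨fun k => ⟨0, hd k⟩⟩
    have : Nonempty ι := ψ.toBasis.index_nonempty
    exact hno (Classical.arbitrary ι) (h _)
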